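/- Let $\mathbb{K}=\mathbb{R}$ or $\mathbb{K}=\mathbb{C}$. For $n\times n$ matrices $A,B$ with entries in $\mathbb{K}$, let $$\langle A,B\rangle=\{A^{m_1}B^{n_1}\cdots A^{m_k}B^{n_k} : k\ge 1,\ m_i,n_i\ge 0\}$$ be the semigroup generated by $A$ and $B$, acting on $\mathbb{K}^n$ by matrix-vector multiplication. The action of a semigroup $G$ on a topological space $X$ is called topologically transitive if for all nonempty open sets $U,V\subseteq X$ there is $f\in G$ with $f(U)\cap V\neq\emptyset$, and topologically $k$-transitive if the induced action $f(x_1,\dots,x_k)=(f(x_1),\dots,f(x_k))$ on the product $X^k$ is topologically transitive. Theorem. For every $n\ge 1$, and for both $\mathbb{K}=\mathbb{R}$ and $\mathbb{K}=\mathbb{C}$, there exist $n\times n$ matrices $A,B$ with entries in $\mathbb{K}$ such that the action of $\langle A,B\rangle$ on $\mathbb{K}^n$ is topologically $n$-transitive. -/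

import Mathlib

/-- The action of a monoid `M` on a topological space `X` is topologically `k`-transitive if the
induced diagonal action `(m • x) i = m • x i` on the Cartesian power `X ^ k` (with the product
topology) is topologically transitive. -/
def IsTopologicallyKTransitive (k : ℕ) (M X : Type*) [Monoid M] [TopologicalSpace X]
    [MulAction M X] : Prop :=
  MulAction.IsTopologicallyTransitive M (Fin k → X)

/-- The semigroup `⟨A, B⟩` of all products `A ^ m₁ * B ^ n₁ * ⋯ * A ^ mₖ * B ^ nₖ` with exponents
`≥ 0`, i.e. all finite products of factors `A` and `B`, the identity matrix (all exponents zero)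
included.  It acts on column vectors by matrix-vector multiplication. -/
def generatedSemigroup {n : ℕ} {𝕜 : Type*} [Semiring 𝕜] (A B : Matrix (Fin n) (Fin n) 𝕜) :
    Submonoid (Matrix (Fin n) (Fin n) 𝕜) :=
  Submonoid.closure {A, B}

/-! Invertible matrices are dense, and `Q * P⁻¹` carries the columns of `P` to those of `Q`; so it
suffices that the closure `S` of the semigroup contains all invertible matrices. Take `A = E(-1/N,
0) • σ` and `B = E(β, φ) • R(θ)`, where `E` is the exponential, `σ` a cyclic permutation matrix up
to sign, `σ ^ N = 1`, and `R` the circle group generated by `X = κ e₀₁ - κ⁻¹ e₁₀`. The products `A ^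
(N m) * B ^ q` are scalars times rotations, and for generic `β, φ, θ` (Baire) they are dense among
these. Hence `S` contains the scalars `E(x, y)`, the circle `R` and `σ`.

The velocities of one-parameter groups in `S` form a real Lie algebra, stable under conjugation by
`σ`. It contains the translates of `X` along the cycle of indices. Bracketing from `0` to the last
index and comparing with the edge that closes the cycle gives two elements of one plane, independent
because `κ ^ (2n) ≠ 1`. These yield all off-diagonal matrix units, hence all transvections and all
of `SLₙ`; scalars and `det σ = -1` supply the other determinants
(`single_mem_of_rotation_invariant`, `mem_of_det_ne_zero`). -/

section

open NormedSpace Filter Topology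

/-! ### Tangent spaces of closed submonoids -/

section Banach
variable {𝔸 : Type*} [NormedRing 𝔸] [NormedAlgebra ℝ 𝔸] [CompleteSpace 𝔸]

/-- A curve through `1` with velocity `X` gives the exponential of `X` as a limit of powers. -/
theorem tendsto_pow_exp_of_hasDerivAt {γ : ℝ → 𝔸} {X : 𝔸} (h0 : γ 0 = 1)
    (hγ : HasDerivAt γ X 0) :
    Tendsto (fun m : ℕ => γ ((m : ℝ)⁻¹) ^ m) atTop (𝓝 (exp X)) := by
  let : NormedAlgebra ℚ 𝔸 := NormedAlgebra.restrictScalars ℚ ℝ 𝔸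
  have hexp : HasStrictFDerivAt (exp : 𝔸 → 𝔸)
      ((ContinuousLinearEquiv.refl ℝ 𝔸 : 𝔸 ≃L[ℝ] 𝔸) : 𝔸 →L[ℝ] 𝔸) 0 :=
    hasStrictFDerivAt_exp_zero (𝕂 := ℝ)
  -- `L` is a local logarithm: `γ(1/m) ^ m = exp (m • L (γ(1/m)))` for large `m`, and the exponent
  -- is a difference quotient tending to `X`.
  set L := hexp.localInverse with hL
  have hLd := hexp.to_localInverse
  have hr : ∀ᶠ y in 𝓝 (γ 0), exp (L y) = y := by
    rw [h0]; simpa using hexp.eventually_right_inverse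
  have hL1 : L 1 = 0 := by simpa using hexp.localInverse_apply_image
  have hd : HasDerivAt (fun t => L (γ t)) X 0 := by
    have h1 : HasFDerivAt L (ContinuousLinearMap.id ℝ 𝔸) (γ 0) := by
      rw [h0]; simpa using hLd.hasFDerivAt
    simpa [Function.comp_def] using h1.comp_hasDerivAt (0 : ℝ) hγ
  have hinv : Tendsto (fun m : ℕ => ((m : ℝ)⁻¹)) atTop (𝓝[≠] 0) := by
    refine tendsto_nhdsWithin_iff.2 ⟨tendsto_inv_atTop_nhds_zero_nat, ?_⟩
    filter_upwards [eventually_gt_atTop 0] with m hm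
    simp; omega
  have hs := (hasDerivAt_iff_tendsto_slope.1 hd).comp hinv
  have hs' : Tendsto (fun m : ℕ => exp (m • L (γ ((m : ℝ)⁻¹)))) atTop (𝓝 (exp X)) := by
    refine (exp_continuous.tendsto X).comp (hs.congr fun m => ?_)
    simp [slope_def_module, h0, hL1, Nat.cast_smul_eq_nsmul]
  refine hs'.congr' ?_
  have := (hγ.continuousAt.tendsto.comp (hinv.mono_right nhdsWithin_le_nhds)).eventually hr
  filter_upwards [this] with m hm
  rw [exp_nsmul]
  simp only [Function.comp] at hm
  rw [hm]

/-- If a closed submonoid contains a curve through `1` with velocity `X`, then it contains the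
one-parameter semigroup generated by `X`. -/
theorem exp_smul_mem_of_hasDerivAt {S : Submonoid 𝔸} (hS : IsClosed (S : Set 𝔸)) {γ : ℝ → 𝔸}
    {X : 𝔸} (h0 : γ 0 = 1) (hγ : HasDerivAt γ X 0) (hmem : ∀ t, γ t ∈ S) (t : ℝ) :
    exp (t • X) ∈ S := by
  have h1 : HasDerivAt (fun s => γ (t * s)) (t • X) 0 := by
    have h2 : HasDerivAt γ X (t * 0) := by simpa using hγ
    have h3 : HasDerivAt (fun s : ℝ => t * s) t 0 := by
      simpa using (hasDerivAt_id (0 : ℝ)).const_mul t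
    exact h2.scomp 0 h3
  exact hS.mem_of_tendsto (tendsto_pow_exp_of_hasDerivAt (by simpa using h0) h1)
    (Eventually.of_forall fun m => S.pow_mem (hmem _) m)

theorem hasDerivAt_exp_smul_zero (X : 𝔸) : HasDerivAt (fun t : ℝ => exp (t • X)) X 0 := by
  simpa using hasDerivAt_exp_smul_const (𝕂 := ℝ) X (0 : ℝ)

theorem exp_smul_mul_exp_neg_smul (X : 𝔸) (t : ℝ) : exp (t • X) * exp ((-t) • X) = 1 := by
  let : NormedAlgebra ℚ 𝔸 := NormedAlgebra.restrictScalars ℚ ℝ 𝔸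
  rw [← exp_add_of_commute ((Commute.refl X).smul_left t |>.smul_right (-t)), ← add_smul]
  simp

theorem exp_conj_of_mul_eq_one {g h : 𝔸} (h1 : g * h = 1) (h2 : h * g = 1) (Y : 𝔸) :
    exp (g * Y * h) = g * exp Y * h := by
  let : NormedAlgebra ℚ 𝔸 := NormedAlgebra.restrictScalars ℚ ℝ 𝔸
  exact exp_units_conj (⟨g, h, h1, h2⟩ : 𝔸ˣ) Y

/-- The tangent space at `1` of a closed submonoid of a Banach algebra: the generators of the
one-parameter groups that it contains. -/
def Submonoid.tangentSpace (S : Submonoid 𝔸) (hS : IsClosed (S : Set 𝔸)) : Submodule ℝ 𝔸 where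
  carrier := {X | ∀ t : ℝ, exp (t • X) ∈ S}
  zero_mem' t := by simp [S.one_mem]
  add_mem' {X Y} hX hY t := by
    refine exp_smul_mem_of_hasDerivAt hS (γ := fun t => exp (t • X) * exp (t • Y)) (by simp) ?_
      (fun t => S.mul_mem (hX t) (hY t)) t
    simpa using (hasDerivAt_exp_smul_zero X).fun_mul (hasDerivAt_exp_smul_zero Y)
  smul_mem' c X hX t := by rw [smul_smul]; exact hX _

variable {S : Submonoid 𝔸} {hS : IsClosed (S : Set 𝔸)}

theorem Submonoid.mem_tangentSpace {X : 𝔸} :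
    X ∈ S.tangentSpace hS ↔ ∀ t : ℝ, exp (t • X) ∈ S := Iff.rfl

theorem Submonoid.exp_mem_of_mem_tangentSpace {X : 𝔸} (hX : X ∈ S.tangentSpace hS) :
    exp X ∈ S := by
  simpa using Submonoid.mem_tangentSpace.1 hX 1

theorem Submonoid.mem_tangentSpace_of_hasDerivAt {γ : ℝ → 𝔸} {X : 𝔸} (h0 : γ 0 = 1)
    (hγ : HasDerivAt γ X 0) (hmem : ∀ t, γ t ∈ S) : X ∈ S.tangentSpace hS :=
  exp_smul_mem_of_hasDerivAt hS h0 hγ hmem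

theorem Submonoid.conj_mem_tangentSpace {g h Y : 𝔸} (h1 : g * h = 1) (h2 : h * g = 1)
    (hg : g ∈ S) (hh : h ∈ S) (hY : Y ∈ S.tangentSpace hS) :
    g * Y * h ∈ S.tangentSpace hS := by
  intro t
  have := exp_conj_of_mul_eq_one h1 h2 (t • Y)
  rw [mul_smul_comm, smul_mul_assoc] at this
  rw [this]
  exact S.mul_mem (S.mul_mem hg (hY t)) hh

/-- The tangent space of a closed submonoid is closed under commutators. -/
theorem Submonoid.commutator_mem_tangentSpace {X Y : 𝔸} (hX : X ∈ S.tangentSpace hS)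
    (hY : Y ∈ S.tangentSpace hS) : X * Y - Y * X ∈ S.tangentSpace hS := by
  set C : Set 𝔸 := {X | ∀ t : ℝ, exp (t • X) ∈ S} with hC
  have hCcl : IsClosed C := by
    let : NormedAlgebra ℚ 𝔸 := NormedAlgebra.restrictScalars ℚ ℝ 𝔸
    rw [hC, Set.ofPred_forall]
    exact isClosed_iInter fun t => hS.preimage (exp_continuous.comp (by fun_prop))
  -- The bracket is the velocity of the conjugates of `Y`. Their difference quotients are
  -- combinations of tangent vectors, and the tangent space is closed.
  have hd : HasDerivAt (fun t : ℝ => exp (t • X) * Y * exp ((-t) • X)) (X * Y - Y * X) 0 := by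
    have h1 := (hasDerivAt_exp_smul_zero X).mul_const Y
    have h2 : HasDerivAt (fun t : ℝ => exp ((-t) • X)) (-X) 0 := by
      simpa using hasDerivAt_exp_smul_zero (-X)
    have h3 := h1.fun_mul h2
    simpa [sub_eq_add_neg] using h3
  refine hCcl.mem_of_tendsto (hasDerivAt_iff_tendsto_slope.1 hd) (Eventually.of_forall ?_)
  intro s t
  have key : exp (t • slope (fun t : ℝ => exp (t • X) * Y * exp ((-t) • X)) 0 s) =
      exp ((t • (s - 0)⁻¹) • (exp (s • X) * Y * exp ((-s) • X) + (-1 : ℝ) • Y)) := by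
    simp [slope_def_module, smul_smul, sub_eq_add_neg]
  rw [key]
  have hZ : exp (s • X) * Y * exp ((-s) • X) ∈ C :=
    Submonoid.conj_mem_tangentSpace (hS := hS) (exp_smul_mul_exp_neg_smul X s)
      (by simpa using exp_smul_mul_exp_neg_smul X (-s)) (hX _) (hX _) hY
  refine exp_smul_mem_of_hasDerivAt hS
    (γ := fun t => exp (t • (exp (s • X) * Y * exp ((-s) • X))) * exp (t • ((-1 : ℝ) • Y)))
    (by simp) ?_ (fun t => S.mul_mem (hZ t) (by rw [smul_smul]; exact hY _)) _
  simpa using (hasDerivAt_exp_smul_zero (exp (s • X) * Y * exp ((-s) • X))).fun_mul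
    (hasDerivAt_exp_smul_zero ((-1 : ℝ) • Y))

end Banach

end

/-! ### Density of generic combinations, by Baire category -/

/-- For generic real `β, φ, θ` the combinations below are dense in `ℝ³`. -/
theorem exists_dense_nat_combinations : ∃ β φ θ : ℝ,
    Dense {p : ℝ × ℝ × ℝ | ∃ (m q : ℕ) (k l : ℤ),
      p = (q * β - m, q * φ - 2 * Real.pi * k, q * θ - 2 * Real.pi * l)} := by
  set f : ℕ → ℕ → ℤ → ℤ → ℝ × ℝ × ℝ → ℝ × ℝ × ℝ := fun m q k l v =>
    (q * v.1 - m, q * v.2.1 - 2 * Real.pi * k, q * v.2.2 - 2 * Real.pi * l) with hf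
  have hfc : ∀ m q k l, Continuous (f m q k l) := fun m q k l => by simp only [hf]; fun_prop
  let 𝓑 := TopologicalSpace.countableBasis (ℝ × ℝ × ℝ)
  -- For `β < 0` the numbers `q * β - m` are never positive, so that half-space is added to keep `W
  -- V` dense; the final point is taken with `β > 0`.
  let W : Set (ℝ × ℝ × ℝ) → Set (ℝ × ℝ × ℝ) := fun V =>
    {v | v.1 < 0} ∪ ⋃ m, ⋃ q, ⋃ k, ⋃ l, f m q k l ⁻¹' V
  have hWo : ∀ V ∈ 𝓑, IsOpen (W V) := fun V hV => by
    have hVo := (TopologicalSpace.isBasis_countableBasis (ℝ × ℝ × ℝ)).isOpen hV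
    refine (isOpen_lt continuous_fst continuous_const).union ?_
    exact isOpen_iUnion fun m => isOpen_iUnion fun q => isOpen_iUnion fun k => isOpen_iUnion
      fun l => hVo.preimage (hfc m q k l)
  have hWd : ∀ V ∈ 𝓑, Dense (W V) := by
    rintro V hV
    obtain ⟨⟨x, y, z⟩, hV'⟩ := TopologicalSpace.nonempty_of_mem_countableBasis hV
    rw [Metric.dense_iff]
    rintro ⟨b, s, t⟩ r hr
    by_cases hb : b < 0
    · exact ⟨(b, s, t), Metric.mem_ball_self hr, Or.inl hb⟩
    push Not at hb
    set b' := b + r / 2 with hb'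
    have hb'0 : 0 < b' := by positivity
    -- The first bound makes `m` below a natural number; the second makes rounding to a multiple of
    -- `2π`, divided by `q`, cost less than `r / 2`.
    obtain ⟨q, hq⟩ := exists_nat_gt (max (x / b') (2 * Real.pi / (r / 2)))
    have hq1 : x < q * b' := by
      have := (le_max_left _ _).trans_lt hq
      rwa [div_lt_iff₀ hb'0] at this
    have hq2 : 2 * Real.pi < q * (r / 2) := by
      have := (le_max_right _ _).trans_lt hq
      rwa [div_lt_iff₀ (by positivity)] at this
    have hpi := Real.pi_gt_three
    have hq0 : (0 : ℝ) < q := by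
      by_contra h
      nlinarith
    have round : ∀ c u v : ℝ, 0 < c → c ≤ 2 * Real.pi → ∀ j : ℤ, j = ⌊(q * v - u) / c⌋ →
        |(u + c * j) / q - v| < r / 2 := by
      intro c u v hc hc' j hj
      have h1 : (j : ℝ) ≤ (q * v - u) / c := by rw [hj]; exact Int.floor_le _
      have h2 : (q * v - u) / c < j + 1 := by rw [hj]; exact Int.lt_floor_add_one _
      rw [le_div_iff₀ hc] at h1
      rw [div_lt_iff₀ hc] at h2
      rw [div_sub' hq0.ne', abs_div, abs_of_pos hq0, div_lt_iff₀ hq0, abs_lt]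
      constructor <;> nlinarith
    have hm : ((⌊q * b' - x⌋₊ : ℕ) : ℝ) = ((⌊(q * b' - x) / 1⌋ : ℤ) : ℝ) := by
      rw [div_one]
      exact natCast_floor_eq_intCast_floor (sub_nonneg.2 hq1.le)
    set m := ⌊q * b' - x⌋₊
    set k := ⌊(q * s - y) / (2 * Real.pi)⌋ with hk
    set l := ⌊(q * t - z) / (2 * Real.pi)⌋ with hl
    have e1 := round 1 x b' one_pos (by linarith) _ rfl
    have e2 := round (2 * Real.pi) y s (by positivity) le_rfl k hk
    have e3 := round (2 * Real.pi) z t (by positivity) le_rfl l hl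
    rw [one_mul, ← hm] at e1
    refine ⟨((x + m) / q, (y + 2 * Real.pi * k) / q, (z + 2 * Real.pi * l) / q), ?_, Or.inr ?_⟩
    · simp only [Metric.mem_ball, Prod.dist_eq, Real.dist_eq, max_lt_iff]
      refine ⟨?_, by linarith, by linarith⟩
      rw [abs_lt] at e1 ⊢
      constructor <;> linarith
    · simp only [Set.mem_iUnion, Set.mem_preimage]
      refine ⟨m, q, k, l, ?_⟩
      convert hV' using 1
      simp only [hf, Prod.mk.injEq]
      refine ⟨?_, ?_, ?_⟩ <;> field_simp <;> ring
  have hD := dense_biInter_of_isOpen hWo (TopologicalSpace.countable_countableBasis _) hWd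
  obtain ⟨v, hv0, hv⟩ := hD.inter_open_nonempty {v : ℝ × ℝ × ℝ | 0 < v.1}
    (isOpen_lt continuous_const continuous_fst) ⟨(1, 0, 0), by simp⟩
  refine ⟨v.1, v.2.1, v.2.2, ?_⟩
  rw [(TopologicalSpace.isBasis_countableBasis (ℝ × ℝ × ℝ)).dense_iff]
  intro V hV _
  have := Set.mem_iInter₂.1 hv V hV
  rcases this with h | h
  · exact ((lt_asymm (show v.1 < 0 from h)) hv0).elim
  · simp only [Set.mem_iUnion, Set.mem_preimage] at h
    obtain ⟨m, q, k, l, h⟩ := h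
    exact ⟨_, h, m, q, k, l, rfl⟩

/-! ### Off-diagonal matrix units in a rotation-invariant Lie algebra -/

section

open Matrix

section Commutators
variable {ι R : Type*} [Fintype ι] [DecidableEq ι] [CommRing R]

theorem commutator_single_chain {i j k : ι} (hij : i ≠ j) (hjk : j ≠ k) (hik : i ≠ k)
    (a b c d : R) :
    (single i j a - single j i b) * (single j k c - single k j d) -
      (single j k c - single k j d) * (single i j a - single j i b) =
      single i k (a * c) - single k i (b * d) := by
  simp [sub_mul, mul_sub, single_mul_single_of_ne, hij, hjk, hik, hij.symm, hjk.symm, hik.symm,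
    mul_comm]

theorem commutator_single_plane {i j : ι} (hij : i ≠ j) (a b c d : R) :
    (single i j a + single j i b) * (single i j c + single j i d) -
      (single i j c + single j i d) * (single i j a + single j i b) =
      single i i (a * d - b * c) - single j j (a * d - b * c) := by
  simp [add_mul, mul_add, single_mul_single_of_ne, hij, hij.symm, sub_eq_add_neg, single_add,
    single_neg, mul_comm]
  abel

theorem commutator_single_diag {i j : ι} (hij : i ≠ j) (h a b : R) :
    (single i i h - single j j h) * (single i j a + single j i b) -
      (single i j a + single j i b) * (single i i h - single j j h) =
      single i j (2 * h * a) + single j i (-(2 * h * b)) := by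
  simp [sub_mul, mul_sub, add_mul, mul_add, single_mul_single_of_ne, hij, hij.symm,
    single_neg]
  rw [two_mul, add_mul, add_mul, single_add, neg_add, single_add, mul_comm a h,
    mul_comm b h, ← single_neg]
  abel

theorem commutator_single_single {i j k : ι} (hik : i ≠ k) (a b : R) :
    single i j a * single j k b - single j k b * single i j a = single i k (a * b) := by
  simp [single_mul_single_of_ne, hik.symm]

/-- This is why the two entries of the generator are `κ` and `-κ⁻¹`: its one-parameter group is then
`2π`-periodic. -/
theorem single_sub_single_cube {i j : ι} (hij : i ≠ j) {a b : R} (hab : a * b = 1) :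
    (single i j a - single j i b) * (single i j a - single j i b) *
      (single i j a - single j i b) = -(single i j a - single j i b) := by
  simp [sub_mul, mul_sub, single_mul_single_of_ne, hij, hij.symm, hab, mul_comm b a]
  abel

end Commutators

open scoped Fin.CommRing in
/-- A real space of matrices that is closed under commutators and under rotation of the indices and
contains a suitable generator of an elliptic circle contains all off-diagonal matrix units. -/
theorem single_mem_of_rotation_invariant {m : ℕ} {K : Type*} [RCLike K] {κ : K}
    (hspan : ∀ z : K, ∃ a b : ℝ, z = a + b * (κ ^ (m + 2) - (κ ^ (m + 2))⁻¹) ^ 2)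
    (hτ : κ ^ (m + 2) - (κ ^ (m + 2))⁻¹ ≠ 0)
    (𝔥 : Submodule ℝ (Matrix (Fin (m + 2)) (Fin (m + 2)) K))
    (hcomm : ∀ X ∈ 𝔥, ∀ Y ∈ 𝔥, X * Y - Y * X ∈ 𝔥)
    (hrot : ∀ X ∈ 𝔥, X.submatrix (finRotate (m + 2)).symm (finRotate (m + 2)).symm ∈ 𝔥)
    (hX : single 0 1 κ - single 1 0 κ⁻¹ ∈ 𝔥) {i j : Fin (m + 2)} (hij : i ≠ j) (c : K) :
    single i j c ∈ 𝔥 := by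
  have hsub : ∀ (i j : Fin (m + 2)) (c : K),
      (single i j c).submatrix (finRotate (m + 2)).symm (finRotate (m + 2)).symm =
        single (i + 1) (j + 1) c := by
    intro i j c
    rw [submatrix_single_equiv]
    simp only [Equiv.symm_symm, finRotate_apply]
  have hXj : ∀ j : ℕ, 
      single ((j : ℕ) : Fin (m + 2)) ((j : Fin (m + 2)) + 1) κ -
        single ((j : Fin (m + 2)) + 1) (j : Fin (m + 2)) κ⁻¹ ∈ 𝔥 := by
    intro j
    induction j with
    | zero => simpa using hX
    | succ j ih =>
      have := hrot _ ih
      rw [submatrix_sub, Pi.sub_apply, Pi.sub_apply, hsub, hsub] at this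
      simpa using this
  have hval : ∀ k : ℕ, k < m + 2 → ((k : Fin (m + 2)) : ℕ) = k := fun k hk =>
    Fin.val_cast_of_lt hk
  have hne : ∀ k l : ℕ, k < m + 2 → l < m + 2 → k ≠ l → (k : Fin (m + 2)) ≠ l := by
    intro k l hk hl hkl h
    exact hkl (by rw [← hval k hk, ← hval l hl, h])
  have hY : ∀ k : ℕ, k + 1 < m + 2 →
      single (0 : Fin (m + 2)) ((k + 1 : ℕ) : Fin (m + 2)) (κ ^ (k + 1)) -
        single ((k + 1 : ℕ) : Fin (m + 2)) 0 (κ⁻¹ ^ (k + 1)) ∈ 𝔥 := by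
    intro k
    induction k with
    | zero => intro _; simpa using hX
    | succ k ih =>
      intro hk
      have h0 : (0 : Fin (m + 2)) = ((0 : ℕ) : Fin (m + 2)) := by simp
      have h2 := hcomm _ (ih (by omega)) _ (hXj (k + 1))
      have e : ((k + 1 : ℕ) : Fin (m + 2)) + 1 = ((k + 1 + 1 : ℕ) : Fin (m + 2)) := by push_cast; rfl
      rw [e, commutator_single_chain (by rw [h0]; exact hne _ _ (by omega) (by omega) (by omega))
        (hne _ _ (by omega) (by omega) (by omega))
        (by rw [h0]; exact hne _ _ (by omega) (by omega) (by omega)), ← pow_succ, ← pow_succ] at h2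
      exact h2
  set L : Fin (m + 2) := ((m + 1 : ℕ) : Fin (m + 2)) with hL
  have hL1 : L + 1 = 0 := by
    have : ((m + 1 + 1 : ℕ) : Fin (m + 2)) = 0 := by simp
    rw [hL, ← this]; push_cast; rfl
  have h0L : (0 : Fin (m + 2)) ≠ L := by
    have := hne 0 (m + 1) (by omega) (by omega) (by omega)
    simpa [hL] using this
  set τ := κ ^ (m + 2) - (κ ^ (m + 2))⁻¹ with hτdef
  -- Two elements of the `(0, L)` plane: `hV1` from the path `0, 1, …, L`, `hV2` from the edge `L,
  -- 0`. Their coefficient determinant is `τ`.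
  have hV1 : single 0 L (κ ^ (m + 1)) + single L 0 (-(κ⁻¹ ^ (m + 1))) ∈ 𝔥 := by
    have := hY m (by omega)
    rwa [sub_eq_add_neg, single_neg] at this
  have hV2 : single 0 L (-κ⁻¹) + single L 0 κ ∈ 𝔥 := by
    have := hXj (m + 1)
    rw [← hL, hL1, sub_eq_add_neg, single_neg] at this
    rwa [add_comm (single L 0 κ)] at this
  have hH : single 0 0 τ - single L L τ ∈ 𝔥 := by
    have := hcomm _ hV1 _ hV2
    rw [commutator_single_plane h0L] at this
    have e : κ ^ (m + 1) * κ - -κ⁻¹ ^ (m + 1) * -κ⁻¹ = τ := by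
      rw [hτdef, ← inv_pow]; ring
    rwa [e] at this
  -- Bracketing twice with `hH` multiplies both entries by `4 * τ ^ 2`; as `1` and `τ ^ 2` span `K`
  -- over `ℝ`, every scalar is reached.
  have hscale : ∀ a b : K, single 0 L a + single L 0 b ∈ 𝔥 → ∀ z : K,
      single 0 L (z * a) + single L 0 (z * b) ∈ 𝔥 := by
    intro a b hab z
    have h2 := hcomm _ hH _ (hcomm _ hH _ hab)
    rw [commutator_single_diag h0L, commutator_single_diag h0L] at h2
    obtain ⟨x, y, rfl⟩ := hspan z
    have h3 := 𝔥.add_mem (𝔥.smul_mem x hab) (𝔥.smul_mem (y / 4) h2)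
    convert h3 using 1
    simp only [smul_add, smul_single, RCLike.real_smul_eq_coe_mul, add_mul]
    rw [add_add_add_comm, ← single_add, ← single_add]
    congr 2 <;> push_cast <;> ring
  have hG : ∀ c : K, single L 0 c ∈ 𝔥 := by
    intro c
    have h1 := hscale _ _ hV1 (c / τ * κ⁻¹)
    have h2 := hscale _ _ hV2 (c / τ * κ ^ (m + 1))
    have h3 := 𝔥.add_mem h1 h2
    have e1 : c / τ * κ⁻¹ * κ ^ (m + 1) + c / τ * κ ^ (m + 1) * -κ⁻¹ = 0 := by ring
    have e2 : c / τ * κ⁻¹ * -κ⁻¹ ^ (m + 1) + c / τ * κ ^ (m + 1) * κ = c := by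
      have : c / τ * κ⁻¹ * -κ⁻¹ ^ (m + 1) + c / τ * κ ^ (m + 1) * κ = c / τ * τ := by
        rw [hτdef, ← inv_pow]; ring
      rw [this, div_mul_cancel₀ _ hτ]
    rw [add_add_add_comm, ← single_add, ← single_add, e1, e2, single_zero, zero_add] at h3
    exact h3
  have hstep : ∀ (k : ℕ) (c : K), single (k : Fin (m + 2)) ((k : Fin (m + 2)) + 1) c ∈ 𝔥 := by
    intro k
    induction k with
    | zero =>
      intro c
      have := hrot _ (hG c)
      rw [hsub, hL1] at this
      simpa using this
    | succ k ih =>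
      intro c
      have := hrot _ (ih c)
      rw [hsub] at this
      simpa using this
  have hall : ∀ (d : ℕ), d + 1 < m + 2 → ∀ (i : Fin (m + 2)) (c : K),
      single i (i + ((d + 1 : ℕ) : Fin (m + 2))) c ∈ 𝔥 := by
    intro d
    induction d with
    | zero =>
      intro _ i c
      have := hstep i c
      simpa using this
    | succ d ih =>
      intro hd i c
      have h1 := ih (by omega) i c
      have h2 := hstep (i + ((d + 1 : ℕ) : Fin (m + 2)) : Fin (m + 2)) 1
      rw [Fin.cast_val_eq_self] at h2
      have h3 := hcomm _ h1 _ h2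
      have e : i + ((d + 1 : ℕ) : Fin (m + 2)) + 1 = i + ((d + 1 + 1 : ℕ) : Fin (m + 2)) := by
        push_cast; ring
      rw [e, commutator_single_single, mul_one] at h3
      · exact h3
      · intro h
        have h4 : ((d + 1 + 1 : ℕ) : Fin (m + 2)) = ((0 : ℕ) : Fin (m + 2)) := by
          simpa using h
        exact hne _ _ hd (by omega) (by omega) h4
  have hd : ((j - i : Fin (m + 2)) : ℕ) ≠ 0 := by
    intro h
    exact hij (sub_eq_zero.1 (Fin.ext (by simpa using h))).symm
  obtain ⟨d, hd'⟩ := Nat.exists_eq_succ_of_ne_zero hd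
  have := hall d (by have := (j - i).isLt; omega) i c
  have e : ((d + 1 : ℕ) : Fin (m + 2)) = j - i := by
    rw [show d + 1 = _ from hd'.symm, Fin.cast_val_eq_self]
  rwa [e, add_sub_cancel] at this

end

/-! ### Unipotent and elliptic one-parameter groups -/

section

open Matrix NormedSpace Filter Topology

section Banach
variable {𝔸 : Type*} [NormedRing 𝔸] [NormedAlgebra ℝ 𝔸]

theorem one_add_smul_pow_of_mul_self_eq_zero {N : 𝔸} (hN : N * N = 0) (a : ℝ) (m : ℕ) :
    (1 + a • N) ^ m = 1 + (m * a) • N := by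
  induction m with
  | zero => simp
  | succ m ih =>
    rw [pow_succ, ih]
    simp only [add_mul, mul_add, one_mul, mul_one, smul_mul_smul_comm, hN, smul_zero, add_zero]
    push_cast
    module

/-- The curve `1 + t • N` has velocity `N`, and `(1 + N / m) ^ m` is exactly `1 + N`. -/
theorem exp_eq_one_add_of_mul_self_eq_zero [CompleteSpace 𝔸] {N : 𝔸} (hN : N * N = 0) : exp N = 1 + N := by
  have h : HasDerivAt (fun t : ℝ => 1 + t • N) N 0 := by
    simpa using ((hasDerivAt_id (0 : ℝ)).smul_const N).const_add 1
  refine tendsto_nhds_unique (tendsto_pow_exp_of_hasDerivAt (by simp) h) ?_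
  refine tendsto_const_nhds.congr' ?_
  filter_upwards [eventually_gt_atTop 0] with m hm
  rw [one_add_smul_pow_of_mul_self_eq_zero hN, mul_inv_cancel₀ (by positivity), one_smul]

end Banach

/-- The one-parameter group of rotations generated by an element `X` with `X ^ 3 = -X`. -/
noncomputable def ellipticRotation {𝔸 : Type*} [Ring 𝔸] [Algebra ℝ 𝔸] (X : 𝔸) (t : ℝ) : 𝔸 :=
  1 + Real.sin t • X + (1 - Real.cos t) • (X * X)

section EllipticRotation
variable {𝔸 : Type*} [Ring 𝔸] [Algebra ℝ 𝔸] {X : 𝔸}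

/-- Rodrigues' formula: `-X ^ 2` is idempotent and `X` is a complex structure on its image. -/
theorem ellipticRotation_add (hX : X * X * X = -X) (s t : ℝ) :
    ellipticRotation X (s + t) = ellipticRotation X s * ellipticRotation X t := by
  have h4 : X * X * (X * X) = -(X * X) := by rw [← mul_assoc, hX, neg_mul]
  have h3 : X * (X * X) = -X := by rw [← mul_assoc, hX]
  simp only [ellipticRotation, add_mul, mul_add, one_mul, mul_one, smul_mul_smul_comm, h4, h3, hX,
    Real.sin_add, Real.cos_add]
  module

theorem ellipticRotation_zero : ellipticRotation X 0 = 1 := by simp [ellipticRotation]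

theorem ellipticRotation_nat_mul (hX : X * X * X = -X) (m : ℕ) (t : ℝ) :
    ellipticRotation X (m * t) = ellipticRotation X t ^ m := by
  induction m with
  | zero => simp [ellipticRotation_zero]
  | succ m ih => rw [pow_succ, ← ih, ← ellipticRotation_add hX]; push_cast; ring_nf

theorem ellipticRotation_sub_int_mul_two_pi (t : ℝ) (l : ℤ) :
    ellipticRotation X (t - 2 * Real.pi * l) = ellipticRotation X t := by
  have e : t - 2 * Real.pi * l = t - l * (2 * Real.pi) := by ring
  rw [ellipticRotation, ellipticRotation, e, Real.sin_sub_int_mul_two_pi, Real.cos_sub_int_mul_two_pi]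

end EllipticRotation

theorem hasDerivAt_ellipticRotation {𝔸 : Type*} [NormedRing 𝔸] [NormedAlgebra ℝ 𝔸] (X : 𝔸) :
    HasDerivAt (ellipticRotation X) X 0 := by
  have h1 := (Real.hasDerivAt_sin 0).smul_const X
  have h2 := ((Real.hasDerivAt_cos 0).const_sub 1).smul_const (X * X)
  have e : ellipticRotation X = fun t : ℝ => 1 + Real.sin t • X + (1 - Real.cos t) • (X * X) := rfl
  rw [e]
  simpa using (h1.const_add 1).fun_add h2

section Matrix
variable {n : ℕ} {K : Type*} [RCLike K]

open scoped Matrix.Norms.Operator in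
/-- The tangent space of a closed submonoid of the algebra of matrices. -/
theorem exists_tangentSpace (S : Submonoid (Matrix (Fin n) (Fin n) K))
    (hS : IsClosed (S : Set (Matrix (Fin n) (Fin n) K))) :
    ∃ 𝔥 : Submodule ℝ (Matrix (Fin n) (Fin n) K),
      (∀ X ∈ 𝔥, ∀ Y ∈ 𝔥, X * Y - Y * X ∈ 𝔥) ∧
      (∀ g h X : Matrix (Fin n) (Fin n) K, g * h = 1 → h * g = 1 → g ∈ S → h ∈ S → X ∈ 𝔥 →
        g * X * h ∈ 𝔥) ∧
      (∀ X, (∀ t : ℝ, ellipticRotation X t ∈ S) → X ∈ 𝔥) ∧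
      (∀ N ∈ 𝔥, N * N = 0 → 1 + N ∈ S) := by
  refine ⟨S.tangentSpace hS, ?_, ?_, ?_, ?_⟩
  · exact fun X hX Y hY => Submonoid.commutator_mem_tangentSpace hX hY
  · exact fun g h X h1 h2 hg hh hX => Submonoid.conj_mem_tangentSpace h1 h2 hg hh hX
  · exact fun X hX =>
      Submonoid.mem_tangentSpace_of_hasDerivAt ellipticRotation_zero (hasDerivAt_ellipticRotation X) hX
  · intro N hN h0
    rw [← exp_eq_one_add_of_mul_self_eq_zero h0]
    exact Submonoid.exp_mem_of_mem_tangentSpace hN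

end Matrix

end

/-! ### From transvections to transitivity -/

section

open Matrix Filter Topology

section Generation
variable {n : ℕ} {K : Type*} [RCLike K]

/-- Whitehead's identity `diag(c, c⁻¹) = w(c) w(-1)` with `w(c) = e_ij(c) e_ji(-c⁻¹) e_ij(c)`. -/
theorem diag2n_eq_prod_transvection {ι F : Type*} [Fintype ι] [DecidableEq ι] [Field F]
    {i j : ι} (hij : i ≠ j) {c : F} (hc : c ≠ 0) :
    (SpecialLinearGroup.diag2n hij c hc : Matrix ι ι F) =
      transvection i j c * transvection j i (-c⁻¹) * transvection i j c *
        (transvection i j (-1) * transvection j i 1 * transvection i j (-1)) := by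
  have hd : (SpecialLinearGroup.diag2n hij c hc : Matrix ι ι F) =
      1 + single i i (c - 1) + single j j (c⁻¹ - 1) := by
    rw [SpecialLinearGroup.diag2n_coe]
    ext a b
    rcases eq_or_ne a b with rfl | hab
    · simp only [diagonal_apply_eq, Matrix.add_apply, one_apply_eq, single_apply, and_self]
      grind
    · simp only [diagonal_apply_ne _ hab, Matrix.add_apply, one_apply_ne hab, single_apply]
      grind
  have h1 : transvection i j c * transvection j i (-c⁻¹) * transvection i j c =
      1 - single i i 1 - single j j 1 + single i j c + single j i (-c⁻¹) := by
    simp [transvection, add_mul, mul_add, single_mul_single_of_ne, hij.symm, hc]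
    simp only [← single_neg]
    abel
  have h2 : transvection i j (-1 : F) * transvection j i 1 * transvection i j (-1) =
      1 - single i i 1 - single j j 1 + single i j (-1) + single j i 1 := by
    simp [transvection, add_mul, mul_add, single_mul_single_of_ne, hij.symm]
    simp only [← single_neg]
    abel
  rw [hd, h1, h2]
  simp [add_mul, mul_add, single_mul_single_of_ne, hij, hij.symm,
    sub_eq_add_neg, single_add]
  simp only [← single_neg]
  abel

/-- A submonoid containing all transvections contains all matrices of determinant one. -/
theorem mem_of_det_eq_one {ι F : Type*} [Fintype ι] [DecidableEq ι] [Field F]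
    (S : Submonoid (Matrix ι ι F))
    (hS : ∀ i j : ι, i ≠ j → ∀ c : F, transvection i j c ∈ S) {M : Matrix ι ι F}
    (hM : M.det = 1) : M ∈ S := by
  cases subsingleton_or_nontrivial ι with
  | inl h =>
    have : M = 1 := by
      cases isEmpty_or_nonempty ι with
      | inl h => exact Subsingleton.elim _ _
      | inr h =>
        obtain ⟨i⟩ := h
        rw [det_eq_elem_of_subsingleton M i] at hM
        ext a b
        rw [Subsingleton.elim a i, Subsingleton.elim b i, hM, one_apply_eq]
    exact this ▸ S.one_mem
  | inr h =>
    refine SpecialLinearGroup.diagonal_transvection_induction' (fun M => (M : Matrix ι ι F) ∈ S)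
      ⟨M, hM⟩ ?_ ?_ ?_
    · intro i j hij c hc
      rw [diag2n_eq_prod_transvection]
      have h1 := hS i j hij
      have h2 := hS j i hij.symm
      exact S.mul_mem (S.mul_mem (S.mul_mem (h1 _) (h2 _)) (h1 _))
        (S.mul_mem (S.mul_mem (h1 _) (h2 _)) (h1 _))
    · exact fun i j hij a => hS i j hij a
    · intro A B hA hB
      exact S.mul_mem hA hB

/-- Invertible matrices are dense. -/
theorem dense_det_ne_zero : Dense {M : Matrix (Fin n) (Fin n) K | M.det ≠ 0} := by
  intro M
  have hfin : {t : K | (M + t • 1).det = 0}.Finite := by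
    refine (Polynomial.finite_setOfPred_isRoot (p := (-M).charpoly) (charpoly_monic _).ne_zero).subset
      ?_
    intro t ht
    simp only [Set.mem_ofPred_eq, Polynomial.IsRoot, eval_charpoly, sub_neg_eq_add] at ht ⊢
    rw [← ht, scalar_apply, ← smul_one_eq_diagonal, add_comm]
  have hcont : Continuous (fun t : K => M + t • (1 : Matrix (Fin n) (Fin n) K)) := by fun_prop
  have hd : Dense ({t : K | (M + t • 1).det = 0}ᶜ) := hfin.countable.dense_compl ℝ
  have := hcont.range_subset_closure_image_dense hd
  have h2 : M ∈ _ := this ⟨0, by simp⟩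
  refine closure_mono ?_ h2
  rintro _ ⟨t, ht, rfl⟩
  exact ht

/-- If the closure of a submonoid of the algebra of `n × n` matrices contains all invertible
matrices, then its action on column vectors is topologically `n`-transitive. -/
theorem isTopologicallyKTransitive_of_closure (S : Submonoid (Matrix (Fin n) (Fin n) K))
    (hS : ∀ M : Matrix (Fin n) (Fin n) K, M.det ≠ 0 → M ∈ closure (S : Set (Matrix (Fin n) (Fin n) K))) :
    IsTopologicallyKTransitive n S (Fin n → K) := by
  refine ⟨fun {U V} hU hUne hV hVne => ?_⟩
  -- An `n`-tuple of vectors is the matrix with these columns; the diagonal action becomes left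
  -- multiplication.
  let T : Matrix (Fin n) (Fin n) K → (Fin n → Fin n → K) := fun M i j => M j i
  have hT : Continuous T := by
    refine continuous_pi fun i => continuous_pi fun j => ?_
    exact continuous_id.matrix_elem j i
  have hne : ∀ W : Set (Fin n → Fin n → K), IsOpen W → W.Nonempty →
      ∃ M : Matrix (Fin n) (Fin n) K, T M ∈ W ∧ M.det ≠ 0 := by
    rintro W hW ⟨w, hw⟩
    obtain ⟨M, h1, h2⟩ := dense_det_ne_zero.inter_open_nonempty _ (hW.preimage hT)
      ⟨Matrix.of fun i j => w j i, hw⟩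
    exact ⟨M, h1, h2⟩
  obtain ⟨P, hPU, hP⟩ := hne U hU hUne
  obtain ⟨Q, hQV, hQ⟩ := hne V hV hVne
  have hPu : IsUnit P.det := isUnit_iff_ne_zero.2 hP
  have hmem := hS (Q * P⁻¹) (by
    rw [det_mul, det_nonsing_inv, Ring.inverse_eq_inv']
    exact mul_ne_zero hQ (inv_ne_zero hP))
  have hc : Continuous (fun M : Matrix (Fin n) (Fin n) K => T (M * P)) :=
    hT.comp (continuous_id.matrix_mul continuous_const)
  obtain ⟨M, hMV, hMS⟩ := mem_closure_iff.1 hmem _ (hV.preimage hc) (by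
    simpa [Matrix.mul_assoc, nonsing_inv_mul P hPu] using hQV)
  refine ⟨⟨M, hMS⟩, T (M * P), ⟨T P, hPU, ?_⟩, hMV⟩
  funext i j
  simp only [T, Matrix.mul_apply]
  rfl

end Generation

end

/-! ### The two generators -/

section

open Matrix Filter Topology

section Generators
variable {n : ℕ} {K : Type*} [RCLike K]

/-- A continuous homomorphism from `ℝ × ℝ` to the multiplicative monoid of `K`, `2π`-periodic in
the second variable. -/
structure IsPolarExp (E : ℝ → ℝ → K) : Prop where
  zero : E 0 0 = 1
  add : ∀ x y x' y', E (x + x') (y + y') = E x y * E x' y'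
  sub_period : ∀ x y (k : ℤ), E x (y - 2 * Real.pi * k) = E x y
  cont : Continuous fun p : ℝ × ℝ => E p.1 p.2

theorem IsPolarExp.nat_mul {E : ℝ → ℝ → K} (hE : IsPolarExp E) (q : ℕ) (x y : ℝ) :
    E (q * x) (q * y) = E x y ^ q := by
  induction q with
  | zero => simp [hE.zero]
  | succ q ih => rw [pow_succ, ← ih, ← hE.add]; push_cast; ring_nf

theorem continuous_ellipticRotation (X : Matrix (Fin n) (Fin n) K) :
    Continuous (ellipticRotation X) := by
  unfold ellipticRotation
  fun_prop

/-- Two matrices whose semigroup is dense in the monoid generated by the given scalars, a matrix of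
finite order and an elliptic one-parameter group. -/
theorem exists_generators {E : ℝ → ℝ → K} (hE : IsPolarExp E) {σ X : Matrix (Fin n) (Fin n) K}
    {N : ℕ} (hN : 0 < N) (hσ : σ ^ N = 1) (hX : X * X * X = -X) :
    ∃ A B : Matrix (Fin n) (Fin n) K,
      σ ∈ (generatedSemigroup A B).topologicalClosure ∧
      (∀ x y, E x y • (1 : Matrix (Fin n) (Fin n) K) ∈
        (generatedSemigroup A B).topologicalClosure) ∧
      ∀ t, ellipticRotation X t ∈ (generatedSemigroup A B).topologicalClosure := by
  obtain ⟨β, φ, θ, hD⟩ := exists_dense_nat_combinations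
  -- The scale `-1/N` makes `A ^ (N * m)` the scalar `E (-m) 0`.
  set A : Matrix (Fin n) (Fin n) K := E (-(N : ℝ)⁻¹) 0 • σ with hA
  set B : Matrix (Fin n) (Fin n) K := E β φ • ellipticRotation X θ with hB
  have hAS : A ∈ generatedSemigroup A B := Submonoid.subset_closure (by simp)
  have hBS : B ∈ generatedSemigroup A B := Submonoid.subset_closure (by simp)
  let F : ℝ × ℝ × ℝ → Matrix (Fin n) (Fin n) K := fun p => E p.1 p.2.1 • ellipticRotation X p.2.2
  have hF : Continuous F := by
    have h1 : Continuous fun p : ℝ × ℝ × ℝ => E p.1 p.2.1 :=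
      hE.cont.comp (by fun_prop : Continuous fun p : ℝ × ℝ × ℝ => (p.1, p.2.1))
    exact h1.smul ((continuous_ellipticRotation X).comp (by fun_prop))
  have hN' : (N : ℝ) ≠ 0 := by positivity
  have hFmem : ∀ p, F p ∈ (generatedSemigroup A B).topologicalClosure := by
    intro p
    refine closure_mono ?_ (hF.range_subset_closure_image_dense hD ⟨p, rfl⟩)
    rintro _ ⟨_, ⟨m, q, k, l, rfl⟩, rfl⟩
    have h1 : A ^ (N * m) = E (-m) 0 • 1 := by
      rw [hA, smul_pow, pow_mul σ, hσ, one_pow, ← hE.nat_mul]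
      congr 2
      · push_cast; field_simp
      · simp
    have h2 : B ^ q = E (q * β) (q * φ) • ellipticRotation X (q * θ) := by
      rw [hB, smul_pow, hE.nat_mul, ellipticRotation_nat_mul hX]
    have h3 : F (q * β - m, q * φ - 2 * Real.pi * k, q * θ - 2 * Real.pi * l) =
        A ^ (N * m) * B ^ q := by
      simp only [F]
      rw [hE.sub_period, ellipticRotation_sub_int_mul_two_pi, h1, h2, smul_mul_smul_comm, one_mul,
        ← hE.add]
      congr 2 <;> ring
    rw [h3]
    exact mul_mem (pow_mem hAS _) (pow_mem hBS _)
  have hscal : ∀ x y, E x y • (1 : Matrix (Fin n) (Fin n) K) ∈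
      (generatedSemigroup A B).topologicalClosure := by
    intro x y
    simpa [F, ellipticRotation_zero] using hFmem (x, y, 0)
  refine ⟨A, B, ?_, hscal, fun t => by simpa [F, hE.zero] using hFmem (0, 0, t)⟩
  have h1 := mul_mem (hscal (N : ℝ)⁻¹ 0) (Submonoid.le_topologicalClosure _ hAS)
  have h2 : E (N : ℝ)⁻¹ 0 • (1 : Matrix (Fin n) (Fin n) K) * A = σ := by
    rw [hA, smul_mul_smul_comm, one_mul, ← hE.add, add_neg_cancel, add_zero, hE.zero, one_smul]
  rwa [h2] at h1

end Generators

section Cycle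
variable (n : ℕ) (K : Type*) [RCLike K]

/-- The matrix of a cyclic permutation of the basis, with sign chosen so that its determinant is
`-1`. -/
def signedCycle : Matrix (Fin n) (Fin n) K := (-1 : K) ^ n • (finRotate n).permMatrix K

/-- The inverse of `signedCycle`. -/
def signedCycleInv : Matrix (Fin n) (Fin n) K := (-1 : K) ^ n • (finRotate n)⁻¹.permMatrix K

theorem signedCycle_mul_inv : signedCycle n K * signedCycleInv n K = 1 := by
  rw [signedCycle, signedCycleInv, smul_mul_smul_comm, ← permMatrix_mul, inv_mul_cancel,
    permMatrix_one, ← mul_pow]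
  simp

theorem signedCycleInv_mul : signedCycleInv n K * signedCycle n K = 1 := by
  rw [signedCycle, signedCycleInv, smul_mul_smul_comm, ← permMatrix_mul, mul_inv_cancel,
    permMatrix_one, ← mul_pow]
  simp

theorem det_signedCycle (m : ℕ) : (signedCycle (m + 1) K).det = -1 := by
  rw [signedCycle, det_smul, det_permutation, sign_finRotate, Fintype.card_fin, ← pow_mul]
  push_cast
  rw [← pow_add]
  exact Odd.neg_one_pow (by grind)

theorem exists_signedCycle_pow_eq_one : ∃ N : ℕ, 0 < N ∧ signedCycle n K ^ N = 1 := by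
  have hpow : ∀ k : ℕ, (finRotate n).permMatrix K ^ k = ((finRotate n) ^ k).permMatrix K := by
    intro k
    induction k with
    | zero => simp
    | succ k ih => rw [pow_succ, ih, ← permMatrix_mul, ← pow_succ']
  -- The factor `2` kills the sign.
  refine ⟨orderOf (finRotate n) * 2, by have := orderOf_pos (finRotate n); omega, ?_⟩
  rw [signedCycle, smul_pow, hpow, pow_mul (finRotate n), pow_orderOf_eq_one, one_pow,
    permMatrix_one, pow_mul, ← pow_mul _ n, ← pow_mul _ _ 2, mul_comm, pow_mul]
  simp

theorem signedCycleInv_mul_mul (X : Matrix (Fin n) (Fin n) K) :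
    signedCycleInv n K * X * signedCycle n K =
      X.submatrix (finRotate n).symm (finRotate n).symm := by
  rw [signedCycle, signedCycleInv, smul_mul_assoc, smul_mul_smul_comm, ← mul_pow]
  simp only [mul_neg, mul_one, neg_neg, one_pow, one_smul, Equiv.Perm.permMatrix]
  rw [PEquiv.toMatrix_toPEquiv_mul, PEquiv.mul_toMatrix_toPEquiv, submatrix_submatrix]
  rfl

end Cycle

section Transitivity
variable {K : Type*} [RCLike K]

/-- A closed submonoid containing the signed cycle, polar scalars and all transvections contains all
invertible matrices. -/
theorem mem_of_det_ne_zero {m : ℕ} {E : ℝ → ℝ → K} (hE : IsPolarExp E)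
    (hdet : ∀ d : K, d ≠ 0 → ∃ (k : ℕ) (x y : ℝ), d = (-1) ^ k * E x y ^ (m + 1))
    (S : Submonoid (Matrix (Fin (m + 1)) (Fin (m + 1)) K))
    (hσ : signedCycle (m + 1) K ∈ S) (hscal : ∀ x y, E x y • (1 : Matrix _ _ K) ∈ S)
    (htr : ∀ i j : Fin (m + 1), i ≠ j → ∀ c : K, transvection i j c ∈ S)
    {M : Matrix (Fin (m + 1)) (Fin (m + 1)) K} (hM : M.det ≠ 0) : M ∈ S := by
  obtain ⟨k, x, y, hd⟩ := hdet _ hM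
  have hinv : E x y * E (-x) (-y) = 1 := by rw [← hE.add]; simp [hE.zero]
  have hk : signedCycle (m + 1) K ^ k * signedCycleInv (m + 1) K ^ k = 1 :=
    pow_mul_pow_eq_one k (signedCycle_mul_inv (m + 1) K)
  have hdi : (signedCycleInv (m + 1) K).det = -1 := by
    have := congrArg det (signedCycle_mul_inv (m + 1) K)
    rw [det_mul, det_signedCycle, det_one] at this
    linear_combination -this
  have h1 : signedCycleInv (m + 1) K ^ k * (E (-x) (-y) • M) ∈ S := by
    refine mem_of_det_eq_one S htr ?_
    rw [det_mul, det_pow, hdi, det_smul, hd, Fintype.card_fin]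
    calc (-1 : K) ^ k * (E (-x) (-y) ^ (m + 1) * ((-1) ^ k * E x y ^ (m + 1)))
        = ((-1) * (-1)) ^ k * (E x y * E (-x) (-y)) ^ (m + 1) := by
          rw [mul_pow, mul_pow]; ring
      _ = 1 := by rw [hinv]; simp
  have h2 := S.mul_mem (S.mul_mem (hscal x y) (S.pow_mem hσ k)) h1
  have h3 : E x y • (1 : Matrix (Fin (m + 1)) (Fin (m + 1)) K) * signedCycle (m + 1) K ^ k *
      (signedCycleInv (m + 1) K ^ k * (E (-x) (-y) • M)) = M := by
    rw [mul_assoc, ← mul_assoc (signedCycle (m + 1) K ^ k), hk, one_mul, smul_mul_smul_comm,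
      one_mul, hinv, one_smul]
  rwa [h3] at h2

theorem exists_isTopologicallyKTransitive {E : ℝ → ℝ → K} (hE : IsPolarExp E) (n : ℕ) (hn : 1 ≤ n)
    (hdet : ∀ d : K, d ≠ 0 → ∃ (k : ℕ) (x y : ℝ), d = (-1) ^ k * E x y ^ n)
    {κ : K} (hκ : κ ≠ 0) (hτ : κ ^ n - (κ ^ n)⁻¹ ≠ 0)
    (hspan : ∀ z : K, ∃ a b : ℝ, z = a + b * (κ ^ n - (κ ^ n)⁻¹) ^ 2) :
    ∃ A B : Matrix (Fin n) (Fin n) K,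
      IsTopologicallyKTransitive n (generatedSemigroup A B) (Fin n → K) := by
  obtain ⟨N, hN, hσN⟩ := exists_signedCycle_pow_eq_one n K
  match n, hn with
  | 1, _ =>
    obtain ⟨A, B, hσ, hscal, -⟩ := exists_generators hE hN hσN (X := 0) (by simp)
    refine ⟨A, B, isTopologicallyKTransitive_of_closure _ fun M hM => ?_⟩
    exact mem_of_det_ne_zero hE hdet _ hσ hscal
      (fun i j hij => (hij (Subsingleton.elim (α := Fin 1) i j)).elim) hM
  | m + 2, _ =>
    obtain ⟨A, B, hσ, hscal, hR⟩ := exists_generators hE hN hσN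
      (X := single 0 1 κ - single 1 0 κ⁻¹) (single_sub_single_cube zero_ne_one (mul_inv_cancel₀ hκ))
    refine ⟨A, B, isTopologicallyKTransitive_of_closure _ fun M hM => ?_⟩
    obtain ⟨𝔥, hcomm, hconj, hrot, hexp⟩ := exists_tangentSpace
      (generatedSemigroup A B).topologicalClosure (Submonoid.isClosed_topologicalClosure _)
    -- The closure is only known to be a monoid; finite order makes the inverse a power of the
    -- cycle.
    have hσ' : signedCycleInv (m + 2) K ∈ (generatedSemigroup A B).topologicalClosure := by
      have : signedCycleInv (m + 2) K = signedCycle (m + 2) K ^ (N - 1) := by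
        have h1 : signedCycle (m + 2) K ^ (N - 1) * signedCycle (m + 2) K = 1 := by
          rw [← pow_succ, Nat.sub_add_cancel hN, hσN]
        exact (left_inv_eq_right_inv h1 (signedCycle_mul_inv _ K)).symm
      exact this ▸ pow_mem hσ _
    refine mem_of_det_ne_zero hE hdet _ hσ hscal (fun i j hij c => ?_) hM
    refine hexp _ (single_mem_of_rotation_invariant hspan hτ 𝔥 hcomm (fun X hX => ?_)
      (hrot _ hR) hij c) (single_mul_single_of_ne _ _ _ _ hij.symm _)
    rw [← signedCycleInv_mul_mul]
    exact hconj _ _ _ (signedCycleInv_mul _ K) (signedCycle_mul_inv _ K) hσ' hσ hX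

end Transitivity

/-! ### The real and the complex case -/

theorem isPolarExp_real : IsPolarExp (fun x _ : ℝ => Real.exp x) where
  zero := by simp
  add x y x' y' := Real.exp_add x x'
  sub_period _ _ _ := rfl
  cont := by fun_prop

theorem isPolarExp_complex : IsPolarExp (fun x y : ℝ => Complex.exp (x + y * Complex.I)) where
  zero := by simp
  add x y x' y' := by rw [← Complex.exp_add]; push_cast; ring_nf
  sub_period x y k := by
    rw [Complex.exp_eq_exp_iff_exists_int]
    exact ⟨-k, by push_cast; ring⟩
  cont := by fun_prop

end

theorem mainTheorem3 (n : ℕ) (hn : 1 ≤ n) :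
    (∃ A B : Matrix (Fin n) (Fin n) ℝ,
      IsTopologicallyKTransitive n (generatedSemigroup A B) (Fin n → ℝ)) ∧
    (∃ A B : Matrix (Fin n) (Fin n) ℂ,
      IsTopologicallyKTransitive n (generatedSemigroup A B) (Fin n → ℂ)) := by
  have hn0 : n ≠ 0 := by omega
  have hnR : (n : ℝ) ≠ 0 := by exact_mod_cast hn0
  have hnC : (n : ℂ) ≠ 0 := by exact_mod_cast hn0
  constructor
  -- Over `ℝ` only `τ ≠ 0` matters; here `τ = 3/2`. Negative determinants come from the cycle (`k =
  -- 1`).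
  · obtain ⟨κ, hκ⟩ : ∃ κ : ℝ, κ ^ n = 2 :=
      ⟨(2 : ℝ) ^ (n : ℝ)⁻¹, Real.rpow_inv_natCast_pow (by norm_num) hn0⟩
    have hpos : ∀ r : ℝ, 0 < r → r = Real.exp (Real.log r / n) ^ n := by
      intro r hr
      rw [← Real.exp_nat_mul, mul_div_cancel₀ _ hnR, Real.exp_log hr]
    refine exists_isTopologicallyKTransitive isPolarExp_real n hn ?_ (κ := κ) ?_ ?_ ?_
    · intro d hd
      rcases hd.lt_or_gt with h | h
      · exact ⟨1, Real.log (-d) / n, 0, by rw [← hpos _ (neg_pos.2 h)]; ring⟩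
      · exact ⟨0, Real.log d / n, 0, by rw [← hpos _ h]; ring⟩
    · rintro rfl
      rw [zero_pow hn0] at hκ
      norm_num at hκ
    · rw [hκ]; norm_num
    · exact fun z => ⟨z, 0, by simp⟩
  -- Over `ℂ`, `τ ^ 2` must not be real; here it is `-2 + 3/2 * I`.
  · obtain ⟨κ, hκ⟩ := IsAlgClosed.exists_pow_nat_eq (1 + Complex.I) (Nat.pos_of_ne_zero hn0)
    have hinv : (1 + Complex.I)⁻¹ = (1 - Complex.I) / 2 := by
      rw [inv_eq_iff_eq_inv, eq_comm, inv_eq_of_mul_eq_one_right]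
      linear_combination (-1 / 2 : ℂ) * Complex.I_sq
    have hsq : (1 + Complex.I - (1 - Complex.I) / 2) ^ 2 = -2 + 3 / 2 * Complex.I := by
      linear_combination (9 / 4 : ℂ) * Complex.I_sq
    refine exists_isTopologicallyKTransitive isPolarExp_complex n hn ?_ (κ := κ) ?_ ?_ ?_
    · intro d hd
      refine ⟨0, (Complex.log d / n).re, (Complex.log d / n).im, ?_⟩
      rw [Complex.re_add_im, ← Complex.exp_nat_mul, mul_div_cancel₀ _ hnC, Complex.exp_log hd]
      simp
    · rintro rfl
      rw [zero_pow hn0] at hκ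
      simpa using congrArg Complex.re hκ
    · rw [hκ, hinv]
      intro (h : (1 + Complex.I - (1 - Complex.I) / 2 : ℂ) = 0)
      have h2 := hsq
      rw [h] at h2
      norm_num [Complex.ext_iff] at h2
    · intro z
      refine ⟨z.re + 4 / 3 * z.im, 2 / 3 * z.im, ?_⟩
      rw [hκ, hinv, hsq]
      conv_lhs => rw [← Complex.re_add_im z]
      simp only [Complex.coe_algebraMap]
      push_cast
      ring
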